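/- For $n\ge 1$ write $N=2^n$. For functions $f,g:\{0,1\}^n\to\{\pm1\}$ and a permutation $\pi$ of $\{0,1\}^n$, let $U_{f,g,\pi}=U_\pi U_g H^{\otimes n}U_f$ be the unitary on $n$ qubits, where $U_f|x\rangle=f(x)|x\rangle$, $U_g|x\rangle=g(x)|x\rangle$, $U_\pi|x\rangle=|\pi(x)\rangle$ and $H$ is the one-qubit Hadamard matrix. For $s,t\in\mathbb N$ let $$\rho_{\mathrm{uni}_{s,t}}=\frac{1}{N(N-1)\cdots(N-st+1)}\sum_{z}\ \sum_{\sigma\in S_t^s}|z\rangle\langle\sigma(z)|,$$ where $z=(z_{j,i})_{j\in[s],\,i\in[t]}$ ranges over all $st$-tuples of pairwise distinct elements of $\{0,1\}^n$, $S_t^s=S_t\times\cdots\times S_t$ is the group of permutations of $[s]\times[t]$ that preserve each block $\{j\}\times[t]$, and $\sigma(z)_{j,i}=z_{\sigma(j,i)}$ (if $st>N$ there is no such $z$, and $\rho_{\mathrm{uni}_{s,t}}$ is read as $0$). Let $\|A\|_1=\operatorname{Tr}\sqrt{AA^\dagger}$ denote the trace norm. There is an absolute constant $C$ such that for all $n\ge1$,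 all $s,t\in\mathbb N$ (in particular for $s,t$ that are polynomials in $n$) and all orthonormal $n$-qubit states $|\psi^{(1)}\rangle,\dots,|\psi^{(s)}\rangle\in\mathbb C^{\{0,1\}^n}$, $$\left\|\ \mathop{\mathbb E}_{f,g,\pi}\left[U_{f,g,\pi}^{\otimes st}\left(\bigotimes_{j\in[s]}\bigl(|\psi^{(j)}\rangle\langle\psi^{(j)}|\bigr)^{\otimes t}\right)\bigl(U_{f,g,\pi}^\dagger\bigr)^{\otimes st}\right]-\rho_{\mathrm{uni}_{s,t}}\right\|_1\le C\,\frac{s^6t^4n^2}{N},$$ where $f,g$ are independent uniformly random functions $\{0,1\}^n\to\{\pm1\}$ and $\pi$ is an independent uniformly random permutation of $\{0,1\}^n$. -/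

import Mathlib

open scoped Matrix BigOperators

noncomputable section

namespace OrthPRU

/-- The trace norm `‖A‖₁ = Tr √(A A†)` of a square complex matrix, i.e. the sum of its singular
values; the square root is that of the continuous functional calculus of Hermitian matrices. -/
def traceNorm {ι : Type*} [Fintype ι] [DecidableEq ι] (A : Matrix ι ι ℂ) : ℝ :=
  (cfc Real.sqrt (A * Aᴴ)).trace.re

/-- The tensor product `⨂ k, A k` of matrices, in the product basis. -/
def tensor {κ α : Type*} [Fintype κ] (A : κ → Matrix α α ℂ) : Matrix (κ → α) (κ → α) ℂ :=
  Matrix.of fun x y => ∏ k, A k (x k) (y k)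

/-- Bit strings of length `n`, the labels of the computational basis of `n` qubits. -/
abbrev Bits (n : ℕ) : Type := Fin n → Bool

/-- The pure state `|ψ⟩⟨ψ|` as a matrix. -/
def ketbra {n : ℕ} (ψ : EuclideanSpace ℂ (Bits n)) : Matrix (Bits n) (Bits n) ℂ :=
  Matrix.of fun x y => ψ x * star (ψ y)

/-- The one-qubit Hadamard matrix. -/
def hadamard : Matrix Bool Bool ℂ :=
  Matrix.of fun a b => (if a && b then -1 else 1) / (Real.sqrt 2 : ℂ)

/-- The phase unitary `|x⟩ ↦ f x |x⟩`, where `ℤˣ = {1, -1}`. -/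
def phaseU {n : ℕ} (f : Bits n → ℤˣ) : Matrix (Bits n) (Bits n) ℂ :=
  Matrix.diagonal fun x => (((f x : ℤˣ) : ℤ) : ℂ)

/-- The permutation unitary `|x⟩ ↦ |π x⟩`. -/
def permU {n : ℕ} (π : Equiv.Perm (Bits n)) : Matrix (Bits n) (Bits n) ℂ :=
  ∑ x, Matrix.single (π x) x 1

/-- The unitary `U_π U_g H^{⊗n} U_f`. -/
def circuitU {n : ℕ} (f g : Bits n → ℤˣ) (π : Equiv.Perm (Bits n)) :
    Matrix (Bits n) (Bits n) ℂ :=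
  permU π * phaseU g * tensor (fun _ : Fin n => hadamard) * phaseU f

/-- The `t`-fold copies of `s` states: `⨂_{j ∈ [s]} (|ψ j⟩⟨ψ j|)^{⊗ t}`. The `s * t` registers are
indexed by pairs `(j, i)`. -/
def inputState {n s : ℕ} (t : ℕ) (ψ : Fin s → EuclideanSpace ℂ (Bits n)) :
    Matrix (Fin s × Fin t → Bits n) (Fin s × Fin t → Bits n) ℂ :=
  tensor fun p : Fin s × Fin t => ketbra (ψ p.1)

/-- The expectation over independent uniform `f`, `g`, `π` of
`U_{f,g,π}^{⊗ st} (⨂_j (|ψ j⟩⟨ψ j|)^{⊗ t}) (U_{f,g,π}^†)^{⊗ st}`. -/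
def outputState {n s : ℕ} (t : ℕ) (ψ : Fin s → EuclideanSpace ℂ (Bits n)) :
    Matrix (Fin s × Fin t → Bits n) (Fin s × Fin t → Bits n) ℂ :=
  𝔼 f : Bits n → ℤˣ, 𝔼 g : Bits n → ℤˣ, 𝔼 π : Equiv.Perm (Bits n),
    tensor (fun _ : Fin s × Fin t => circuitU f g π) * inputState t ψ *
      tensor (fun _ : Fin s × Fin t => (circuitU f g π)ᴴ)

/-- `ρ_uni = (1 / N(N-1)⋯(N-st+1)) ∑_{z, σ} |z⟩⟨σ(z)|` with `N = 2 ^ n`. Here `z` ranges over the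
`st`-tuples of pairwise distinct `n`-bit strings, `σ` over the block-preserving permutations
`S_t × ⋯ × S_t` of the index set `[s] × [t]`, and `σ(z)_{(j, i)} = z_{σ(j, i)}`. -/
def rhoUni (n s t : ℕ) : Matrix (Fin s × Fin t → Bits n) (Fin s × Fin t → Bits n) ℂ :=
  (1 / ((2 ^ n).descFactorial (s * t) : ℂ)) •
    ∑ z : (Fin s × Fin t) ↪ Bits n, ∑ σ : Fin s → Equiv.Perm (Fin t),
      Matrix.single (z : Fin s × Fin t → Bits n) (fun p => z (Equiv.prodCongrRight σ p)) 1

end OrthPRU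

end

open scoped Matrix BigOperators

noncomputable section

namespace OrthPRU

set_option linter.unusedSectionVars false

/-! Write m = st and N = 2^n. Fix f. The vectors φ_j = H^{⊗n} U_f ψ_j (`spread`) are orthonormal,
and a Rademacher tail bound makes them flat for most f: every |φ_j(x)|² is at most δ = 8n/N. For the
remaining f the trivial bound 2 is used.

For fixed f, averaging over g kills every entry (x, y) with one of x, y injective unless y is a
rearrangement x ∘ σ. Averaging over π makes the entry at (x, x ∘ σ) independent of x. Hence
(`twirl_eq`) the average is a positive part on tuples with collisions plus a combination of matrices
`relabel l k`, with weights `coef φ l k` over the falling factorial. The target state is the term k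
= l with weight 1. Each normalised `relabel l k` has trace norm at most 1, so scalar estimates
suffice: `coef φ l l` is close to 1, which also controls the collision part, and the sum of |`coef φ
l k`| over k ≠ l is small.

These weights are sums over injective tuples. Where k and l differ, orthogonality gives a factor of
total sum zero, so its index can only contribute by colliding with another; each collision costs δ
and uses up at most two such indices. With d disagreements the weight is at most (mδ)^⌈d/2⌉
(`norm_injSum_le_pow`), and summing over k gives O(m³s²δ). Trace norms are bounded throughout by
duality with contractions. -/

/-- `U` is a contraction for the Euclidean norm, stated through its bilinear form. -/
def IsContr {ι : Type*} [Fintype ι] (U : Matrix ι ι ℂ) : Prop :=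
  ∀ v w : ι → ℂ, ‖v ⬝ᵥ U *ᵥ w‖ ≤ √(∑ x, ‖v x‖ ^ 2) * √(∑ x, ‖w x‖ ^ 2)

/-- `b` bounds the pairing of `A` with all contractions, i.e. the dual form of `‖A‖₁ ≤ b`. -/
def DualLE {ι : Type*} [Fintype ι] (A : Matrix ι ι ℂ) (b : ℝ) : Prop :=
  ∀ U, IsContr U → ‖(A * U).trace‖ ≤ b

/-! ### Trace norm by duality with contractions -/

section dual
open scoped ComplexOrder
variable {ι : Type*} [Fintype ι]

lemma norm_dotProduct_le (v w : ι → ℂ) :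
    ‖v ⬝ᵥ w‖ ≤ √(∑ x, ‖v x‖ ^ 2) * √(∑ x, ‖w x‖ ^ 2) := by
  refine (norm_sum_le _ _).trans ?_
  simp_rw [norm_mul]
  exact Real.sum_mul_le_sqrt_mul_sqrt _ _ _

lemma star_dotProduct_self_eq (w : ι → ℂ) :
    star w ⬝ᵥ w = ((∑ x, ‖w x‖ ^ 2 : ℝ) : ℂ) := by
  simp [dotProduct, Complex.conj_mul']

/-- With P = U†U an orthogonal projection, ‖Uw‖² = ⟨w, Pw⟩ = ‖w‖² − ‖w − Pw‖². -/
lemma isContr_of_isHermitian_idempotent [DecidableEq ι] {U : Matrix ι ι ℂ}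
    (h1 : (Uᴴ * U).IsHermitian) (h2 : (Uᴴ * U) * (Uᴴ * U) = Uᴴ * U) : IsContr U := by
  intro v w
  refine (norm_dotProduct_le _ _).trans ?_
  refine mul_le_mul_of_nonneg_left (Real.sqrt_le_sqrt ?_) (Real.sqrt_nonneg _)
  set P := Uᴴ * U with hP
  have e1 : star (U *ᵥ w) ⬝ᵥ (U *ᵥ w) = star w ⬝ᵥ P *ᵥ w := by
    rw [Matrix.star_mulVec, ← Matrix.dotProduct_mulVec, Matrix.mulVec_mulVec]
  have e2 : star (w - P *ᵥ w) ⬝ᵥ (w - P *ᵥ w) = star w ⬝ᵥ w - star w ⬝ᵥ P *ᵥ w := by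
    have e3 : star (P *ᵥ w) = star w ᵥ* P := by rw [Matrix.star_mulVec, h1.eq]
    rw [star_sub, sub_dotProduct, dotProduct_sub, dotProduct_sub, e3,
      ← Matrix.dotProduct_mulVec, ← Matrix.dotProduct_mulVec, Matrix.mulVec_mulVec, h2]
    ring
  rw [← e1, star_dotProduct_self_eq, star_dotProduct_self_eq, star_dotProduct_self_eq,
    ← Complex.ofReal_sub, Complex.ofReal_inj] at e2
  have : 0 ≤ ∑ x, ‖(w - P *ᵥ w) x‖ ^ 2 := by positivity
  linarith

/-- Polar decomposition: U = A†(AA†)^{-1/2} is a partial isometry with AU = √(AA†), so testing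
against it recovers the trace norm. The convention 0⁻¹ = 0 supplies the pseudo-inverse on the
kernel. -/
lemma traceNorm_le_of_dualLE [DecidableEq ι] {A : Matrix ι ι ℂ} {b : ℝ} (h : DualLE A b) :
    traceNorm A ≤ b := by
  have hM : (A * Aᴴ).PosSemidef := Matrix.posSemidef_self_mul_conjTranspose A
  have hsa : IsSelfAdjoint (A * Aᴴ) := hM.isHermitian
  have hc (f : ℝ → ℝ) : ContinuousOn f (spectrum ℝ (A * Aᴴ)) :=
    (Matrix.finite_real_spectrum).continuousOn f
  have hpos : ∀ x ∈ spectrum ℝ (A * Aᴴ), 0 ≤ x := by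
    intro x hx
    rw [hM.isHermitian.spectrum_real_eq_range_eigenvalues] at hx
    obtain ⟨i, rfl⟩ := hx
    exact hM.eigenvalues_nonneg i
  set T := cfc (fun x : ℝ => (√x)⁻¹) (A * Aᴴ) with hT
  have hTsa : Tᴴ = T := cfc_predicate (R := ℝ) (fun x : ℝ => (√x)⁻¹) (A * Aᴴ)
  have hid : A * Aᴴ = cfc (id : ℝ → ℝ) (A * Aᴴ) := (cfc_id ℝ (A * Aᴴ)).symm
  have hAU : A * (Aᴴ * T) = cfc Real.sqrt (A * Aᴴ) := by
    rw [← Matrix.mul_assoc, hT]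
    nth_rewrite 1 [hid]
    rw [← cfc_mul _ _ _ (hc _) (hc _)]
    refine cfc_congr fun x hx => ?_
    rcases eq_or_ne (√x) 0 with h0 | h0
    · have := (Real.sqrt_eq_zero (hpos x hx)).1 h0
      simp [this]
    · simp only [id]
      field_simp
      exact (Real.sq_sqrt (hpos x hx)).symm
  have hUU : (Aᴴ * T)ᴴ * (Aᴴ * T) =
      cfc (fun x : ℝ => (√x)⁻¹ * √x) (A * Aᴴ) := by
    rw [Matrix.conjTranspose_mul, hTsa, Matrix.conjTranspose_conjTranspose, Matrix.mul_assoc,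
      hAU, hT, ← cfc_mul _ _ _ (hc _) (hc _)]
  have hcontr : IsContr (Aᴴ * T) := by
    apply isContr_of_isHermitian_idempotent
    · exact Matrix.isHermitian_conjTranspose_mul_self _
    · rw [hUU, ← cfc_mul _ _ _ (hc _) (hc _)]
      refine cfc_congr fun x hx => ?_
      rcases eq_or_ne (√x) 0 with h0 | h0 <;> simp [h0]
  have := h _ hcontr
  rw [hAU] at this
  exact (Complex.re_le_norm _).trans this

lemma DualLE.mono {A : Matrix ι ι ℂ} {b c : ℝ} (h : DualLE A b) (hbc : b ≤ c) : DualLE A c :=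
  fun U hU => (h U hU).trans hbc

lemma DualLE.add {A B : Matrix ι ι ℂ} {b c : ℝ} (hA : DualLE A b) (hB : DualLE B c) :
    DualLE (A + B) (b + c) := fun U hU => by
  rw [Matrix.add_mul, Matrix.trace_add]
  exact (norm_add_le _ _).trans (add_le_add (hA U hU) (hB U hU))

lemma DualLE.smul {A : Matrix ι ι ℂ} {b : ℝ} (hA : DualLE A b) (c : ℂ) :
    DualLE (c • A) (‖c‖ * b) := fun U hU => by
  rw [Matrix.smul_mul, Matrix.trace_smul, norm_smul]
  exact mul_le_mul_of_nonneg_left (hA U hU) (norm_nonneg _)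

lemma DualLE.sub {A B : Matrix ι ι ℂ} {b c : ℝ} (hA : DualLE A b) (hB : DualLE B c) :
    DualLE (A - B) (b + c) := fun U hU => by
  rw [Matrix.sub_mul, Matrix.trace_sub]
  exact (norm_sub_le _ _).trans (add_le_add (hA U hU) (hB U hU))

lemma DualLE.sum {τ : Type*} {S : Finset τ} {A : τ → Matrix ι ι ℂ} {b : τ → ℝ}
    (h : ∀ i ∈ S, DualLE (A i) (b i)) : DualLE (∑ i ∈ S, A i) (∑ i ∈ S, b i) := fun U hU => by
  rw [Finset.sum_mul, Matrix.trace_sum]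
  exact norm_sum_le_of_le _ fun i hi => h i hi U hU

lemma DualLE.expect {τ : Type*} [Fintype τ] {A : τ → Matrix ι ι ℂ} {b : τ → ℝ}
    (h : ∀ i, DualLE (A i) (b i)) : DualLE (𝔼 i, A i) (𝔼 i, b i) := by
  have := (DualLE.sum (S := Finset.univ) fun i _ => h i).smul ((Fintype.card τ : ℂ)⁻¹)
  convert this using 1
  · rw [Finset.expect, Finset.card_univ]
    ext x y
    simp [NNRat.smul_def]
  · rw [Finset.expect, Finset.card_univ]
    simp [NNRat.smul_def]

lemma dualLE_vecMulVec (v w : ι → ℂ) :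
    DualLE (Matrix.vecMulVec v w) (√(∑ x, ‖w x‖ ^ 2) * √(∑ x, ‖v x‖ ^ 2)) := fun U hU => by
  rw [Matrix.vecMulVec_mul, Matrix.trace_vecMulVec, dotProduct_comm, ← Matrix.dotProduct_mulVec]
  exact hU w v

lemma dualLE_vecMulVec_star (v : ι → ℂ) :
    DualLE (Matrix.vecMulVec v (star v)) (∑ x, ‖v x‖ ^ 2) := by
  convert dualLE_vecMulVec v (star v) using 1
  simp only [Pi.star_apply, norm_star]
  rw [Real.mul_self_sqrt (by positivity)]

/-- A matrix supported on `S × T` given by matching of keys is a sum of rank one matrices with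
disjoint supports. -/
lemma dualLE_of_key {Λ : Type*} [Fintype Λ] [DecidableEq Λ] (S : Finset ι) (F G : ι → Λ)
    [DecidableEq ι] :
    DualLE (Matrix.of fun x y => if x ∈ S ∧ y ∈ S ∧ F x = G y then (1 : ℂ) else 0) S.card := by
  have key : (Matrix.of fun x y => if x ∈ S ∧ y ∈ S ∧ F x = G y then (1 : ℂ) else 0) =
      ∑ l : Λ, Matrix.vecMulVec (fun x => if x ∈ S ∧ F x = l then (1 : ℂ) else 0)
        (fun y => if y ∈ S ∧ G y = l then (1 : ℂ) else 0) := by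
    ext x y
    rw [Matrix.sum_apply]
    simp only [Matrix.of_apply, Matrix.vecMulVec_apply]
    rw [Finset.sum_eq_single (F x)]
    · by_cases h1 : x ∈ S <;> by_cases h2 : y ∈ S <;> simp [h1, h2, eq_comm]
    · intro l _ hl
      simp [Ne.symm hl]
    · simp
  have hsum (F : ι → Λ) : ∑ l, ∑ x, ‖(if x ∈ S ∧ F x = l then (1 : ℂ) else 0)‖ ^ 2 = S.card := by
    rw [Finset.sum_comm]
    have : ∀ x, ∑ l, ‖(if x ∈ S ∧ F x = l then (1 : ℂ) else 0)‖ ^ 2 = if x ∈ S then (1 : ℝ) else 0 := by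
      intro x
      rw [Finset.sum_eq_single (F x)]
      · split_ifs <;> simp_all
      · intro l _ hl
        simp [Ne.symm hl]
      · simp
    simp [this]
  rw [key]
  refine (DualLE.sum fun l _ => dualLE_vecMulVec _ _).mono ?_
  -- Cauchy–Schwarz over the keys: on either side the squared norms add up to the size of S, because
  -- each element has exactly one key.
  refine (Real.sum_sqrt_mul_sqrt_le _ (fun _ => by positivity) (fun _ => by positivity)).trans ?_
  rw [hsum, hsum, Real.mul_self_sqrt (by positivity)]

end dual

/-! ### Sums over tuples of distinct elements -/

/-- The sum of `∏ a, u a (x a)` over tuples `x` of pairwise distinct elements. -/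
def injSum {ι α : Type*} [Fintype ι] [Fintype α] [DecidableEq ι] [DecidableEq α]
    (u : ι → α → ℂ) : ℂ :=
  ∑ x : ι ↪ α, ∏ a, u a (x a)

section injSum
variable {α : Type*} [Fintype α] [DecidableEq α]

lemma injSum_comp_equiv {ι ι' : Type*} [Fintype ι] [DecidableEq ι] [Fintype ι'] [DecidableEq ι']
    (e : ι' ≃ ι) (u : ι → α → ℂ) : injSum (fun a => u (e a)) = injSum u := by
  unfold injSum
  refine Fintype.sum_equiv (Equiv.embeddingCongr e (Equiv.refl α)) _ _ fun x => ?_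
  refine Fintype.prod_equiv e _ _ fun a => ?_
  simp [Equiv.embeddingCongr]

/-- The last coordinate must avoid the values already taken. Its free sum gives the product term,
and a collision with coordinate b merges the two functions into their pointwise product. -/
lemma injSum_option {ι : Type*} [Fintype ι] [DecidableEq ι] (u : Option ι → α → ℂ) :
    injSum u = (∑ y, u none y) * injSum (fun a => u (some a)) -
      ∑ b, injSum (Function.update (fun a => u (some a)) b
        (fun y => u none y * u (some b) y)) := by
  unfold injSum
  have h1 : ∑ x : Option ι ↪ α, ∏ a, u a (x a) =
      ∑ x : ι ↪ α, (∑ y ∈ Finset.univ.filter (fun y => y ∉ Set.range x), u none y) *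
        ∏ a, u (some a) (x a) := by
    rw [Fintype.sum_equiv (Function.Embedding.optionEmbeddingEquiv ι α) _
      (fun p => u none p.2 * ∏ a, u (some a) (p.1 a))]
    · rw [Fintype.sum_sigma]
      refine Finset.sum_congr rfl fun x _ => ?_
      simp only
      rw [← Finset.sum_mul]
      congr 1
      rw [Finset.sum_subtype (p := fun y => y ∈ (Set.range x)ᶜ)]
      simp
    · intro x
      rw [Fintype.prod_option]
      rfl
  rw [h1, Finset.mul_sum, Finset.sum_comm, ← Finset.sum_sub_distrib]
  refine Finset.sum_congr rfl fun x _ => ?_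
  have h2 : ∑ y ∈ Finset.univ.filter (fun y => y ∉ Set.range x), u none y =
      ∑ y, u none y - ∑ b, u none (x b) := by
    rw [← Finset.sum_filter_add_sum_filter_not Finset.univ (fun y => y ∈ Set.range x)]
    have : Finset.univ.filter (fun y => y ∈ Set.range x) = Finset.univ.map x := by
      ext; simp
    rw [this, Finset.sum_map]
    ring
  rw [h2, sub_mul, Finset.sum_mul Finset.univ (fun b => u none (x b))]
  congr 1
  refine Finset.sum_congr rfl fun b _ => ?_
  rw [Fintype.prod_eq_mul_prod_compl b, Fintype.prod_eq_mul_prod_compl b]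
  rw [Function.update_self, mul_assoc]
  congr 2
  refine Finset.prod_congr rfl fun a ha => ?_
  rw [Function.update_of_ne (by simpa using ha)]

lemma norm_injSum_le {ι : Type*} [Fintype ι] [DecidableEq ι] {u : ι → α → ℂ}
    (h : ∀ a, ∑ y, ‖u a y‖ ≤ 1) : ‖injSum u‖ ≤ 1 := by
  unfold injSum
  refine (norm_sum_le _ _).trans ?_
  simp_rw [norm_prod]
  calc ∑ x : ι ↪ α, ∏ a, ‖u a (x a)‖
      = ∑ x ∈ Finset.univ.map ⟨fun x : ι ↪ α => (x : ι → α), DFunLike.coe_injective⟩,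
          ∏ a, ‖u a (x a)‖ := by rw [Finset.sum_map]; rfl
    _ ≤ ∑ x : ι → α, ∏ a, ‖u a (x a)‖ :=
        Finset.sum_le_univ_sum_of_nonneg fun x => by positivity
    _ = ∏ a, ∑ y, ‖u a y‖ := by rw [Finset.prod_univ_sum, Fintype.piFinset_univ]
    _ ≤ 1 := Finset.prod_le_one (fun a _ => by positivity) fun a _ => h a

lemma injSum_update_smul {ι : Type*} [Fintype ι] [DecidableEq ι] (u : ι → α → ℂ) (b : ι)
    (v : α → ℂ) (c : ℂ) :
    injSum (Function.update u b (fun y => c * v y)) = c * injSum (Function.update u b v) := by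
  unfold injSum
  rw [Finset.mul_sum]
  refine Finset.sum_congr rfl fun x _ => ?_
  rw [Fintype.prod_eq_mul_prod_compl b, Fintype.prod_eq_mul_prod_compl b (fun a =>
    Function.update u b v a (x a)), Function.update_self, Function.update_self, mul_assoc]
  congr 2
  refine Finset.prod_congr rfl fun a ha => ?_
  rw [Function.update_of_ne (by simpa using ha), Function.update_of_ne (by simpa using ha)]

/-- The merging step: after extracting a factor `δ`, the merged functions have `ℓ¹` norm `≤ 1`. -/
lemma norm_injSum_merge_le {ι : Type*} [Fintype ι] [DecidableEq ι] {u : ι → α → ℂ}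
    {w : α → ℂ} {δ B : ℝ} (hδ : 0 ≤ δ) (b : ι) (hw : ∀ y, ‖w y‖ ≤ δ)
    (hu : ∑ y, ‖u b y‖ ≤ 1)
    (hB : ∀ v : α → ℂ, ∑ y, ‖v y‖ ≤ 1 → ‖injSum (Function.update u b v)‖ ≤ B) :
    ‖injSum (Function.update u b (fun y => w y * u b y))‖ ≤ δ * B := by
  -- For δ = 0 the function w vanishes, so the identity survives 0⁻¹ = 0.
  have e : (fun y => w y * u b y) = fun y => (δ : ℂ) * ((δ : ℂ)⁻¹ * (w y * u b y)) := by
    funext y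
    rcases hδ.eq_or_lt with h0 | h0
    · have := hw y
      rw [← h0, norm_le_zero_iff] at this
      simp [this]
    · have : (δ : ℂ) ≠ 0 := by exact_mod_cast h0.ne'
      field_simp
  rw [e, injSum_update_smul, norm_mul, Complex.norm_real, Real.norm_of_nonneg hδ]
  refine mul_le_mul_of_nonneg_left (hB _ ?_) hδ
  refine le_trans (Finset.sum_le_sum fun y _ => ?_) hu
  rw [norm_mul, norm_mul, norm_inv, Complex.norm_real, Real.norm_of_nonneg hδ, ← mul_assoc]
  refine mul_le_of_le_one_left (norm_nonneg _) ?_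
  rcases hδ.eq_or_lt with h0 | h0
  · simp [← h0]
  · rw [inv_mul_le_iff₀ h0, mul_one]
    exact hw y

lemma sum_norm_update_le {ι β : Type*} [Fintype β] [DecidableEq ι] {u : ι → β → ℂ}
    (h : ∀ a, ∑ y, ‖u a y‖ ≤ 1) {v : β → ℂ} (hv : ∑ y, ‖v y‖ ≤ 1) (b a : ι) :
    ∑ y, ‖Function.update u b v a y‖ ≤ 1 := by
  by_cases hab : a = b
  · subst hab; simpa using hv
  · simpa [Function.update_of_ne hab] using h a

/-- Eliminating a zero-sum coordinate leaves only its collisions, at most m of them, each costing δ.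
A collision removes the coordinate and at most one other from Z, so j rounds need only 2j − 1
elements of Z. The index type shrinks at each round and is therefore quantified inside the
induction. -/
lemma norm_injSum_le_pow {δ : ℝ} (hδ : 0 ≤ δ) (m j : ℕ) :
    ∀ {ι : Type} [Fintype ι] [DecidableEq ι] (_ : Fintype.card ι ≤ m) (u : ι → α → ℂ)
      (Z : Finset ι) (_ : ∀ a, ∑ y, ‖u a y‖ ≤ 1) (_ : ∀ a ∈ Z, ∑ y, u a y = 0)
      (_ : ∀ a ∈ Z, ∀ y, ‖u a y‖ ≤ δ) (_ : 2 * j ≤ Z.card + 1), ‖injSum u‖ ≤ (m * δ) ^ j := by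
  induction j with
  | zero => intro ι _ _ _ u Z h _ _ _; simpa using norm_injSum_le h
  | succ j ih =>
    intro ι _ _ hm u Z h h0 hs hj
    obtain ⟨a, ha⟩ : Z.Nonempty := Finset.card_pos.1 (by omega)
    let e := Equiv.optionSubtypeNe a
    rw [← injSum_comp_equiv e, injSum_option]
    have en : e none = a := rfl
    have es : ∀ b, e (some b) = b.1 := fun b => rfl
    simp only [en, es, h0 a ha, zero_mul, zero_sub, norm_neg]
    have hcard : Fintype.card {x // x ≠ a} ≤ m :=
      (Fintype.card_subtype_le _).trans hm
    have hb : ∀ b : {x // x ≠ a}, ‖injSum (Function.update (fun c : {x // x ≠ a} => u c) b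
        (fun y => u a y * u b y))‖ ≤ δ * (m * δ) ^ j := by
      intro b
      refine norm_injSum_merge_le (u := fun c : {x // x ≠ a} => u c) hδ b (hs a ha) (h b) ?_
      intro v hv
      refine ih hcard _ ((Z.subtype (· ≠ a)).erase b)
        (sum_norm_update_le (u := fun c : {x // x ≠ a} => u c) (fun c => h c) hv b) ?_ ?_ ?_
      · intro c hc
        rw [Finset.mem_erase, Finset.mem_subtype] at hc
        rw [Function.update_of_ne hc.1]
        exact h0 _ hc.2
      · intro c hc
        rw [Finset.mem_erase, Finset.mem_subtype] at hc
        rw [Function.update_of_ne hc.1]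
        exact hs _ hc.2
      · have h1 := Finset.pred_card_le_card_erase (s := Z.subtype (· ≠ a)) (a := b)
        have h2 : (Z.subtype (· ≠ a)).card = Z.card - 1 := by
          rw [Finset.card_subtype, Finset.filter_ne', Finset.card_erase_of_mem ha]
        omega
    refine (norm_sum_le_of_le _ fun b _ => hb b).trans ?_
    rw [Finset.sum_const, Finset.card_univ, nsmul_eq_mul, pow_succ', ← mul_assoc]
    gcongr

/-- Removing a coordinate of total sum 1 leaves the same problem with one index fewer, up to m
collisions of size δ; the errors accumulate through m² + m ≤ (m + 1)². -/
lemma norm_injSum_sub_one_le {δ : ℝ} (hδ : 0 ≤ δ) (m : ℕ) :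
    ∀ {ι : Type} [Fintype ι] [DecidableEq ι] (_ : Fintype.card ι = m) (u : ι → α → ℂ)
      (_ : ∀ a, ∑ y, ‖u a y‖ ≤ 1) (_ : ∀ a, ∑ y, u a y = 1)
      (_ : ∀ a, ∀ y, ‖u a y‖ ≤ δ), ‖injSum u - 1‖ ≤ m ^ 2 * δ := by
  induction m with
  | zero =>
    intro ι _ _ hm u _ _ _
    have := Fintype.card_eq_zero_iff.1 hm
    have h1 : injSum u = 1 := by
      unfold injSum
      simp
    simp [h1]
  | succ m ih =>
    intro ι _ _ hm u h h1 hs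
    obtain ⟨a⟩ : Nonempty ι := Fintype.card_pos_iff.1 (by omega)
    let e := Equiv.optionSubtypeNe a
    rw [← injSum_comp_equiv e, injSum_option]
    have en : e none = a := rfl
    have es : ∀ b, e (some b) = b.1 := fun b => rfl
    simp only [en, es, h1 a, one_mul]
    have hcard : Fintype.card {x // x ≠ a} = m := by
      have := Fintype.card_congr e
      rw [Fintype.card_option] at this
      omega
    have hb : ∀ b : {x // x ≠ a}, ‖injSum (Function.update (fun c : {x // x ≠ a} => u c) b
        (fun y => u a y * u b y))‖ ≤ δ * 1 := fun b =>
      norm_injSum_merge_le (u := fun c : {x // x ≠ a} => u c) hδ b (hs a) (h b) fun v hv =>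
        norm_injSum_le (sum_norm_update_le (u := fun c : {x // x ≠ a} => u c) (fun c => h c) hv b)
    have h3 := ih hcard (fun c : {x // x ≠ a} => u c) (fun c => h c) (fun c => h1 c) fun c => hs c
    have h4 := norm_sum_le_of_le Finset.univ fun b _ => hb b
    rw [Finset.sum_const, Finset.card_univ, nsmul_eq_mul, hcard] at h4
    rw [sub_right_comm]
    refine (norm_sub_le _ _).trans ((add_le_add h3 h4).trans ?_)
    push_cast
    nlinarith [(Nat.cast_nonneg m : (0 : ℝ) ≤ m), mul_nonneg (Nat.cast_nonneg m : (0 : ℝ) ≤ m) hδ]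

end injSum

/-! ### Overlaps of product vectors of flat orthonormal families -/

section coef
variable {α κ Λ : Type} [Fintype α] [DecidableEq α] [Fintype κ] [DecidableEq κ] [Fintype Λ]
  [DecidableEq Λ]

/-- The overlap of the product vector with labels `l` and the one with labels `k`, restricted to
tuples of pairwise distinct elements. -/
def coef (φ : Λ → α → ℂ) (l k : κ → Λ) : ℂ :=
  injSum fun p y => φ (l p) y * star (φ (k p) y)

/-- Orthonormality of a family of vectors given by their coordinates. -/
def IsOrthoFamily (φ : Λ → α → ℂ) : Prop :=
  ∀ j k, ∑ y, φ j y * star (φ k y) = if j = k then 1 else 0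

variable {φ : Λ → α → ℂ}

lemma IsOrthoFamily.sum_norm_sq (h : IsOrthoFamily φ) (j : Λ) : ∑ y, ‖φ j y‖ ^ 2 = 1 := by
  have := h j j
  simp only [Complex.star_def, Complex.mul_conj', if_true] at this
  exact_mod_cast this

lemma IsOrthoFamily.sum_norm_mul_le (h : IsOrthoFamily φ) (j k : Λ) :
    ∑ y, ‖φ j y * star (φ k y)‖ ≤ 1 := by
  simp_rw [norm_mul, norm_star]
  refine (Real.sum_mul_le_sqrt_mul_sqrt _ _ _).trans ?_
  simp [h.sum_norm_sq]

lemma norm_mul_star_le {δ : ℝ} (hδ : ∀ j y, ‖φ j y‖ ^ 2 ≤ δ) (j k : Λ) (y : α) :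
    ‖φ j y * star (φ k y)‖ ≤ δ := by
  rw [norm_mul, norm_star]
  nlinarith [hδ j y, hδ k y, sq_nonneg (‖φ j y‖ - ‖φ k y‖)]

lemma norm_coef_self_sub_one_le (h : IsOrthoFamily φ) {δ : ℝ} (hδ0 : 0 ≤ δ)
    (hδ : ∀ j y, ‖φ j y‖ ^ 2 ≤ δ) (l : κ → Λ) :
    ‖coef φ l l - 1‖ ≤ (Fintype.card κ : ℝ) ^ 2 * δ :=
  norm_injSum_sub_one_le hδ0 _ rfl _ (fun _ => h.sum_norm_mul_le _ _)
    (fun a => (h (l a) (l a)).trans (if_pos rfl)) fun _ _ => norm_mul_star_le hδ _ _ _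

lemma norm_coef_le_pow (h : IsOrthoFamily φ) {δ : ℝ} (hδ0 : 0 ≤ δ)
    (hδ : ∀ j y, ‖φ j y‖ ^ 2 ≤ δ) (l k : κ → Λ) {j : ℕ}
    (hj : 2 * j ≤ (Finset.univ.filter fun p => k p ≠ l p).card + 1) :
    ‖coef φ l k‖ ≤ (Fintype.card κ * δ) ^ j := by
  refine norm_injSum_le_pow hδ0 _ j le_rfl _ (Finset.univ.filter fun p => k p ≠ l p)
    (fun _ => h.sum_norm_mul_le _ _) (fun a ha => ?_) (fun _ _ _ => norm_mul_star_le hδ _ _ _) hj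
  have : l a ≠ k a := by simpa [eq_comm] using ha
  exact (h (l a) (k a)).trans (if_neg this)

lemma norm_coef_le_prod (h : IsOrthoFamily φ) {δ ρ : ℝ} (hδ0 : 0 ≤ δ)
    (hδ : ∀ j y, ‖φ j y‖ ^ 2 ≤ δ) (hρ0 : 0 < ρ) (hρ1 : ρ ≤ 1) (l k : κ → Λ) (hkl : k ≠ l)
    (hq : Fintype.card κ * δ ≤ ρ ^ 2) :
    ‖coef φ l k‖ ≤ Fintype.card κ * δ / ρ ^ 2 * ∏ p, if k p = l p then 1 else ρ := by
  set d := (Finset.univ.filter fun p => k p ≠ l p).card with hd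
  have hd0 : 0 < d := by
    obtain ⟨p, hp⟩ := Function.ne_iff.1 hkl
    exact Finset.card_pos.2 ⟨p, by simpa using hp⟩
  have hprod : (∏ p, if k p = l p then 1 else ρ) = ρ ^ d := by
    rw [Finset.prod_ite]; simp [hd]
  -- Here j + 1 = ⌈d/2⌉. One factor q is kept as the gain, and the other j are traded for powers of
  -- ρ².
  obtain ⟨j, hj1, hj2⟩ : ∃ j, 2 * (j + 1) ≤ d + 1 ∧ d ≤ 2 * (j + 1) :=
    ⟨(d + 1) / 2 - 1, by omega, by omega⟩
  refine (norm_coef_le_pow h hδ0 hδ l k hj1).trans ?_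
  have hq0 : 0 ≤ Fintype.card κ * δ := by positivity
  rw [hprod, pow_succ']
  set q := Fintype.card κ * δ
  calc q * q ^ j ≤ q * (ρ ^ 2) ^ j := by gcongr
    _ = q / ρ ^ 2 * ρ ^ (2 * (j + 1)) := by rw [mul_add, pow_add, pow_mul]; field_simp
    _ ≤ q / ρ ^ 2 * ρ ^ d :=
        mul_le_mul_of_nonneg_left (pow_le_pow_of_le_one hρ0.le hρ1 hj2) (by positivity)

/-- The sum over labellings factorises over registers, each contributing one agreement and at most
|Λ| disagreements. -/
lemma sum_prod_label_le (l : κ → Λ) {ρ : ℝ} (hρ0 : 0 ≤ ρ) :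
    ∑ k : κ → Λ, ∏ p, (if k p = l p then 1 else ρ) ≤
      (1 + Fintype.card Λ * ρ) ^ Fintype.card κ := by
  have e : ∑ k : κ → Λ, ∏ p, (if k p = l p then 1 else ρ) =
      ∏ p, ∑ c, if c = l p then 1 else ρ := by
    rw [Finset.prod_univ_sum, Fintype.piFinset_univ]
  rw [e, ← Finset.card_univ (α := κ)]
  rw [← Finset.prod_const]
  refine Finset.prod_le_prod (fun p _ => Finset.sum_nonneg fun c _ => ?_) fun p _ => ?_
  · split_ifs <;> positivity
  have : ∀ c, (if c = l p then 1 else ρ) ≤ (if c = l p then 1 else 0) + ρ := by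
    intro c; split_ifs <;> linarith
  refine (Finset.sum_le_sum fun c _ => this c).trans ?_
  simp [Finset.sum_add_distrib]

lemma sum_norm_coef_le (h : IsOrthoFamily φ) {δ : ℝ} (hδ0 : 0 ≤ δ)
    (hδ : ∀ j y, ‖φ j y‖ ^ 2 ≤ δ) (l : κ → Λ)
    (hq : (Fintype.card κ : ℝ) ^ 3 * (Fintype.card Λ : ℝ) ^ 2 * δ ≤ 1) :
    ∑ k ∈ Finset.univ.erase l, ‖coef φ l k‖ ≤
      3 * ((Fintype.card κ : ℝ) ^ 3 * (Fintype.card Λ : ℝ) ^ 2 * δ) := by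
  rcases isEmpty_or_nonempty κ with hκ | ⟨⟨p0⟩⟩
  · rw [Finset.sum_eq_zero]
    · positivity
    · intro k hk
      exact absurd (Subsingleton.elim k l) (Finset.ne_of_mem_erase hk)
  have hm : (1 : ℝ) ≤ Fintype.card κ := by exact_mod_cast Fintype.card_pos_iff.2 ⟨p0⟩
  have hs : (1 : ℝ) ≤ Fintype.card Λ := by exact_mod_cast Fintype.card_pos_iff.2 ⟨l p0⟩
  set m : ℝ := ((Fintype.card κ : ℕ) : ℝ) with hmdef
  set s : ℝ := ((Fintype.card Λ : ℕ) : ℝ) with hsdef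
  have hms : 1 ≤ m * s := by nlinarith
  -- This choice makes the sum over labellings at most (1 + 1/m)^m ≤ e, while the prefactor mδ/ρ²
  -- becomes m³s²δ.
  set ρ : ℝ := 1 / (m * s) with hρ
  have hρ0 : 0 < ρ := by positivity
  have hρ1 : ρ ≤ 1 := by rw [hρ, div_le_one (by positivity)]; exact hms
  have hq' : m * δ ≤ ρ ^ 2 := by
    rw [hρ, div_pow, one_pow, le_div_iff₀ (by positivity)]
    linarith
  have e1 : m * δ / ρ ^ 2 = m ^ 3 * s ^ 2 * δ := by rw [hρ]; field_simp
  calc ∑ k ∈ Finset.univ.erase l, ‖coef φ l k‖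
      ≤ ∑ k ∈ Finset.univ.erase l, m * δ / ρ ^ 2 * ∏ p, (if k p = l p then 1 else ρ) :=
        Finset.sum_le_sum fun k hk => norm_coef_le_prod h hδ0 hδ hρ0 hρ1 l k
          (Finset.ne_of_mem_erase hk) hq'
    _ ≤ ∑ k : κ → Λ, m * δ / ρ ^ 2 * ∏ p, (if k p = l p then 1 else ρ) := by
        refine Finset.sum_le_univ_sum_of_nonneg fun k => ?_
        refine mul_nonneg (by positivity) (Finset.prod_nonneg fun p _ => ?_)
        split_ifs <;> positivity
    _ ≤ m ^ 3 * s ^ 2 * δ * (1 + s * ρ) ^ Fintype.card κ := by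
        rw [← Finset.mul_sum, e1]
        exact mul_le_mul_of_nonneg_left (sum_prod_label_le l hρ0.le) (by positivity)
    _ ≤ m ^ 3 * s ^ 2 * δ * 3 := by
        refine mul_le_mul_of_nonneg_left ?_ (by positivity)
        have e2 : s * ρ = 1 / m := by rw [hρ]; field_simp
        rw [e2]
        calc (1 + 1 / m) ^ Fintype.card κ ≤ Real.exp (1 / m) ^ Fintype.card κ := by
              gcongr
              linarith [Real.add_one_le_exp (1 / m)]
          _ = Real.exp 1 := by
              rw [← Real.exp_nat_mul, ← hmdef]; congr 1; field_simp
          _ ≤ 3 := by linarith [Real.exp_one_lt_d9]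
    _ = _ := by ring

end coef

/-! ### Averaging over random signs and permutations -/

section twirl
variable {α κ Λ : Type} [Fintype α] [DecidableEq α] [Fintype κ] [DecidableEq κ] [Fintype Λ]
  [DecidableEq Λ]

/-- The value of a sign as a complex number. -/
def sgn (e : ℤˣ) : ℂ := ((e : ℤ) : ℂ)

lemma sgn_mul_self (e : ℤˣ) : sgn e * sgn e = 1 := by
  rcases Int.units_eq_one_or e with rfl | rfl <;> simp [sgn]

lemma star_sgn (e : ℤˣ) : star (sgn e) = sgn e := by simp [sgn]

lemma norm_sgn (e : ℤˣ) : ‖sgn e‖ = 1 := by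
  rcases Int.units_eq_one_or e with rfl | rfl <;> simp [sgn]

lemma prod_sgn_comp_perm (g : α → ℤˣ) (x : κ → α) (σ : Equiv.Perm κ) :
    (∏ p, sgn (g (x p))) * ∏ p, sgn (g ((x ∘ σ) p)) = 1 := by
  have : ∏ p, sgn (g ((x ∘ σ) p)) = ∏ p, sgn (g (x p)) :=
    Equiv.prod_comp σ fun p => sgn (g (x p))
  rw [this, ← Finset.prod_mul_distrib]
  simp [sgn_mul_self]

lemma exists_perm_of_range_subset {x y : κ → α} (hx : Function.Injective x)
    (h : ∀ p, x p ∈ Set.range y) : ∃ σ : Equiv.Perm κ, y = x ∘ σ := by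
  choose τ hτ using h
  have hinj : Function.Injective τ := fun a b hab => hx (by rw [← hτ a, ← hτ b, hab])
  have hbij := Finite.injective_iff_bijective.1 hinj
  refine ⟨(Equiv.ofBijective τ hbij).symm, ?_⟩
  funext p
  obtain ⟨q, rfl⟩ := hbij.2 p
  have : (Equiv.ofBijective τ hbij).symm (τ q) = q := (Equiv.ofBijective τ hbij).symm_apply_apply q
  rw [Function.comp_apply, this, hτ]

/-- Some value of x is missed by y. Flipping g there negates exactly one factor, since x is
injective, so the sum equals its own negative. -/
lemma sum_sgn_eq_zero {x y : κ → α} (hx : Function.Injective x)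
    (h : ¬ ∃ σ : Equiv.Perm κ, y = x ∘ σ) :
    ∑ g : α → ℤˣ, (∏ p, sgn (g (x p))) * ∏ p, sgn (g (y p)) = 0 := by
  have h' : ∃ p, x p ∉ Set.range y := by
    by_contra! hc
    exact h (exists_perm_of_range_subset hx hc)
  obtain ⟨p0, hp0⟩ := h'
  set w : α → ℤˣ := Function.update 1 (x p0) (-1) with hw
  have hy : ∀ g : α → ℤˣ, ∏ p, sgn ((w * g) (y p)) = ∏ p, sgn (g (y p)) := by
    intro g
    refine Finset.prod_congr rfl fun p _ => ?_
    have : y p ≠ x p0 := fun e => hp0 ⟨p, e⟩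
    simp [hw, Function.update_of_ne this]
  have hx' : ∀ g : α → ℤˣ, ∏ p, sgn ((w * g) (x p)) = - ∏ p, sgn (g (x p)) := by
    intro g
    rw [Fintype.prod_eq_mul_prod_compl p0,
      Fintype.prod_eq_mul_prod_compl p0 (fun p => sgn (g (x p))), ← neg_mul]
    congr 1
    · simp [hw, sgn]
    · refine Finset.prod_congr rfl fun p hp => ?_
      have : x p ≠ x p0 := fun e => by simp [hx e] at hp
      simp [hw, Function.update_of_ne this]
  have := Equiv.sum_comp (Equiv.mulLeft w)
    fun g : α → ℤˣ => (∏ p, sgn (g (x p))) * ∏ p, sgn (g (y p))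
  simp only [Equiv.coe_mulLeft, hx', hy, neg_mul, Finset.sum_neg_distrib] at this
  exact self_eq_neg.1 this.symm

/-- Permutations act transitively on embeddings, so the average over the group is the uniform
average over all embeddings. -/
lemma expect_perm_comp (F : (κ → α) → ℂ) (x : κ ↪ α) :
    𝔼 π : Equiv.Perm α, F (π ∘ x) =
      (1 / ((Fintype.card α).descFactorial (Fintype.card κ) : ℂ)) * ∑ z : κ ↪ α, F z := by
  have hconst : ∀ z : κ ↪ α, ∑ π : Equiv.Perm α, F (π ∘ z) = ∑ π : Equiv.Perm α, F (π ∘ x) := by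
    intro z
    obtain ⟨τ, hτ⟩ : ∃ τ : Equiv.Perm α, τ ∘ x = z := by
      classical
      refine ⟨((Equiv.ofInjective x x.injective).symm.trans
        (Equiv.ofInjective z z.injective)).extendSubtype, ?_⟩
      funext p
      rw [Function.comp_apply, Equiv.extendSubtype_apply_of_mem _ _ ⟨p, rfl⟩]
      have : (⟨x p, ⟨p, rfl⟩⟩ : Set.range x) = Equiv.ofInjective x x.injective p := rfl
      rw [Equiv.trans_apply, this, Equiv.symm_apply_apply]
      rfl
    rw [← Equiv.sum_comp (Equiv.mulRight τ) (fun π : Equiv.Perm α => F (π ∘ x))]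
    refine Finset.sum_congr rfl fun π _ => ?_
    rw [← hτ]
    rfl
  have hswap : ∑ z : κ ↪ α, ∑ π : Equiv.Perm α, F (π ∘ z) =
      (Fintype.card (Equiv.Perm α) : ℂ) * ∑ z : κ ↪ α, F z := by
    rw [Finset.sum_comm]
    have : ∀ π : Equiv.Perm α, ∑ z : κ ↪ α, F (π ∘ z) = ∑ z : κ ↪ α, F z := by
      intro π
      refine Fintype.sum_equiv (Equiv.embeddingCongr (Equiv.refl κ) π) _ _ fun z => ?_
      rfl
    simp [this]
  simp only [hconst, Finset.sum_const, Finset.card_univ, nsmul_eq_mul] at hswap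
  rw [Fintype.card_embedding_eq] at hswap
  have hne : ((Fintype.card α).descFactorial (Fintype.card κ) : ℂ) ≠ 0 := by
    rw [← Fintype.card_embedding_eq]
    exact_mod_cast (Fintype.card_pos_iff.2 ⟨x⟩).ne'
  have hne2 : (Fintype.card (Equiv.Perm α) : ℂ) ≠ 0 := by
    exact_mod_cast Fintype.card_ne_zero
  rw [Fintype.expect_eq_sum_div_card]
  field_simp
  linear_combination hswap

/-- The product vector `⨂ p, φ (l p)`. -/
def prodVec (φ : Λ → α → ℂ) (l : κ → Λ) (x : κ → α) : ℂ := ∏ p, φ (l p) (x p)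

/-- The product vector after applying a phase `g` and a permutation `π` on each register. -/
def twirlVec (φ : Λ → α → ℂ) (l : κ → Λ) (g : α → ℤˣ) (π : Equiv.Perm α) (x : κ → α) : ℂ :=
  (∏ p, sgn (g (π.symm (x p)))) * prodVec φ l (π.symm ∘ x)

/-- The average of the pure states `twirlVec φ l g π`. -/
def twirl (φ : Λ → α → ℂ) (l : κ → Λ) : Matrix (κ → α) (κ → α) ℂ :=
  𝔼 g : α → ℤˣ, 𝔼 π : Equiv.Perm α,
    Matrix.vecMulVec (twirlVec φ l g π) (star (twirlVec φ l g π))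

open Classical in
/-- The matrix units `|x⟩⟨x ∘ σ|` with `x` injective and `k ∘ σ = l`, summed. -/
def relabel (l k : κ → Λ) : Matrix (κ → α) (κ → α) ℂ :=
  Matrix.of fun x y => if Function.Injective x ∧ ∃ σ : Equiv.Perm κ, y = x ∘ σ ∧ k ∘ σ = l
    then 1 else 0

lemma expect_apply {ι τ : Type*} [Fintype τ] (A : τ → Matrix ι ι ℂ) (x y : ι) :
    (𝔼 i, A i) x y = 𝔼 i, A i x y := by
  rw [Finset.expect, Finset.expect]
  simp [NNRat.smul_def, Matrix.sum_apply]

lemma twirl_apply (φ : Λ → α → ℂ) (l : κ → Λ) (x y : κ → α) :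
    twirl φ l x y = 𝔼 π : Equiv.Perm α, prodVec φ l (π.symm ∘ x) *
      star (prodVec φ l (π.symm ∘ y)) *
      𝔼 g : α → ℤˣ, (∏ p, sgn (g ((π.symm ∘ x) p))) * ∏ p, sgn (g ((π.symm ∘ y) p)) := by
  simp_rw [twirl, expect_apply]
  rw [Finset.expect_comm]
  refine Finset.expect_congr rfl fun π _ => ?_
  rw [Finset.mul_expect]
  refine Finset.expect_congr rfl fun g _ => ?_
  simp only [Matrix.vecMulVec_apply, Pi.star_apply, twirlVec, star_mul', star_prod, star_sgn,
    Function.comp_apply]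
  ring

lemma twirl_apply_of_not_perm (φ : Λ → α → ℂ) (l : κ → Λ) {x y : κ → α}
    (hx : Function.Injective x) (h : ¬ ∃ σ : Equiv.Perm κ, y = x ∘ σ) : twirl φ l x y = 0 := by
  rw [twirl_apply]
  refine Finset.expect_eq_zero fun π _ => ?_
  rw [Fintype.expect_eq_sum_div_card, sum_sgn_eq_zero (π.symm.injective.comp hx), zero_div,
    mul_zero]
  rintro ⟨σ, hσ⟩
  refine h ⟨σ, ?_⟩
  funext p
  exact π.symm.injective (congrFun hσ p)

lemma twirl_apply_perm (φ : Λ → α → ℂ) (l : κ → Λ) {x : κ → α}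
    (hx : Function.Injective x) (σ : Equiv.Perm κ) :
    twirl φ l x (x ∘ σ) =
      1 / ((Fintype.card α).descFactorial (Fintype.card κ) : ℂ) * coef φ l (l ∘ σ.symm) := by
  rw [twirl_apply]
  have h1 : ∀ π : Equiv.Perm α, 𝔼 g : α → ℤˣ, (∏ p, sgn (g ((π.symm ∘ x) p))) *
      ∏ p, sgn (g ((π.symm ∘ x ∘ σ) p)) = 1 := by
    intro π
    have : ∀ g : α → ℤˣ, (∏ p, sgn (g ((π.symm ∘ x) p))) *
      ∏ p, sgn (g ((π.symm ∘ x ∘ σ) p)) = 1 := fun g => prod_sgn_comp_perm g (π.symm ∘ x) σ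
    simp only [this]
    exact Fintype.expect_const _
  simp only [h1, mul_one]
  have h2 := expect_perm_comp
    (fun z => prodVec φ l z * star (prodVec φ l (z ∘ σ))) ⟨x, hx⟩
  have h3 : ∑ z : κ ↪ α, prodVec φ l z * star (prodVec φ l (z ∘ σ)) =
      coef φ l (l ∘ σ.symm) := by
    rw [coef, injSum]
    refine Finset.sum_congr rfl fun z _ => ?_
    rw [Finset.prod_mul_distrib, prodVec, prodVec, star_prod]
    congr 1
    exact Fintype.prod_equiv σ _ _ fun p => by simp
  rw [h3] at h2
  rw [← h2]
  -- The inverse of a uniform permutation is uniform.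
  exact Fintype.expect_equiv (Equiv.inv _) _ _ fun π => rfl

end twirl

/-! ### Decomposition of the averaged state and its distance to the target -/

section decomposition
variable {α κ Λ : Type} [Fintype α] [DecidableEq α] [Fintype κ] [DecidableEq κ] [Fintype Λ]
  [DecidableEq Λ]

lemma twirl_apply_of_not_perm' (φ : Λ → α → ℂ) (l : κ → Λ) {x y : κ → α}
    (hy : Function.Injective y) (h : ¬ ∃ σ : Equiv.Perm κ, x = y ∘ σ) : twirl φ l x y = 0 := by
  rw [twirl_apply]
  refine Finset.expect_eq_zero fun π _ => ?_
  simp_rw [fun g : α → ℤˣ => mul_comm (∏ p, sgn (g ((π.symm ∘ x) p)))]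
  rw [Fintype.expect_eq_sum_div_card, sum_sgn_eq_zero (π.symm.injective.comp hy), zero_div,
    mul_zero]
  rintro ⟨σ, hσ⟩
  refine h ⟨σ, ?_⟩
  funext p
  exact π.symm.injective (congrFun hσ p)

lemma relabel_apply_perm (l k : κ → Λ) {x : κ → α} (hx : Function.Injective x)
    (σ : Equiv.Perm κ) : relabel l k x (x ∘ σ) = if k = l ∘ σ.symm then 1 else 0 := by
  rw [relabel, Matrix.of_apply]
  refine if_congr ⟨?_, ?_⟩ rfl rfl
  · rintro ⟨-, τ, h1, h2⟩
    have : σ = τ := Equiv.ext fun p => hx (congrFun h1 p)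
    rw [← h2, ← this]
    funext p
    simp
  · rintro rfl
    exact ⟨hx, σ, rfl, by funext p; simp⟩

lemma relabel_apply_of_not_perm (l k : κ → Λ) {x y : κ → α}
    (h : ¬ ∃ σ : Equiv.Perm κ, y = x ∘ σ) : relabel l k x y = 0 := by
  rw [relabel, Matrix.of_apply, if_neg]
  rintro ⟨-, σ, h1, -⟩
  exact h ⟨σ, h1⟩

lemma relabel_apply_of_not_injective (l k : κ → Λ) {x y : κ → α}
    (h : ¬ Function.Injective x) : relabel l k x y = 0 := by
  rw [relabel, Matrix.of_apply, if_neg]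
  exact fun h' => h h'.1

open Classical in
/-- The part of `twirlVec` on tuples with a collision. -/
def collVec (φ : Λ → α → ℂ) (l : κ → Λ) (g : α → ℤˣ) (π : Equiv.Perm α) (x : κ → α) : ℂ :=
  if Function.Injective x then 0 else twirlVec φ l g π x

/-- The part of `twirl` on tuples with a collision. -/
def collPart (φ : Λ → α → ℂ) (l : κ → Λ) : Matrix (κ → α) (κ → α) ℂ :=
  𝔼 g : α → ℤˣ, 𝔼 π : Equiv.Perm α,
    Matrix.vecMulVec (collVec φ l g π) (star (collVec φ l g π))

lemma collPart_apply (φ : Λ → α → ℂ) (l : κ → Λ) (x y : κ → α) :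
    collPart φ l x y = 𝔼 g : α → ℤˣ, 𝔼 π : Equiv.Perm α,
      collVec φ l g π x * star (collVec φ l g π y) := by
  simp_rw [collPart, expect_apply]
  rfl

/-- The sign average decouples injective tuples from those with collisions. At (x, x ∘ σ) with x
injective, only the term k = l ∘ σ⁻¹ is nonzero. -/
lemma twirl_eq (φ : Λ → α → ℂ) (l : κ → Λ) :
    twirl φ l = collPart φ l + ∑ k : κ → Λ,
      (1 / ((Fintype.card α).descFactorial (Fintype.card κ) : ℂ) * coef φ l k) •
        relabel l k := by
  ext x y
  rw [Matrix.add_apply, Matrix.sum_apply]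
  simp only [Matrix.smul_apply, smul_eq_mul]
  by_cases hx : Function.Injective x
  · have h0 : collPart φ l x y = 0 := by simp [collPart_apply, collVec, hx]
    rw [h0, zero_add]
    by_cases h : ∃ σ : Equiv.Perm κ, y = x ∘ σ
    · obtain ⟨σ, rfl⟩ := h
      simp [twirl_apply_perm φ l hx σ, relabel_apply_perm l _ hx σ]
    · simp [twirl_apply_of_not_perm φ l hx h, relabel_apply_of_not_perm l _ h]
  · simp only [relabel_apply_of_not_injective l _ hx, mul_zero, Finset.sum_const_zero, add_zero]
    by_cases hy : Function.Injective y
    · have h0 : collPart φ l x y = 0 := by simp [collPart_apply, collVec, hy]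
      rw [h0, twirl_apply_of_not_perm' φ l hy]
      rintro ⟨σ, rfl⟩
      exact hx (hy.comp σ.injective)
    · rw [collPart_apply, twirl]
      simp_rw [expect_apply]
      simp [collVec, hx, hy, Matrix.vecMulVec_apply]

open Classical in
/-- The labelled set underlying the tuple `x`: each element of its range with its label. -/
def key (k : κ → Λ) (x : κ → α) (a : α) : Option Λ :=
  if h : ∃ p, x p = a then some (k h.choose) else none

lemma key_apply (k : κ → Λ) {x : κ → α} (hx : Function.Injective x) (p : κ) :
    key k x (x p) = some (k p) := by
  have h : ∃ q, x q = x p := ⟨p, rfl⟩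
  rw [key, dif_pos h, hx h.choose_spec]

lemma key_eq_iff (l k : κ → Λ) {x y : κ → α} (hx : Function.Injective x)
    (hy : Function.Injective y) :
    key k x = key l y ↔ ∃ σ : Equiv.Perm κ, y = x ∘ σ ∧ k ∘ σ = l := by
  constructor
  · intro h
    obtain ⟨σ, rfl⟩ : ∃ σ : Equiv.Perm κ, y = x ∘ σ := by
      refine exists_perm_of_range_subset hx fun p => ?_
      by_contra hc
      have := congrFun h (x p)
      rw [key_apply k hx, key, dif_neg (by exact hc)] at this
      exact absurd this (by simp)
    refine ⟨σ, rfl, ?_⟩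
    funext p
    have h1 := congrFun h (x (σ p))
    have h2 := key_apply l hy p
    rw [Function.comp_apply] at h2
    rw [key_apply k hx, h2] at h1
    exact Option.some.inj h1
  · rintro ⟨σ, rfl, rfl⟩
    funext a
    by_cases h : ∃ p, x p = a
    · obtain ⟨p, rfl⟩ := h
      rw [key_apply k hx]
      obtain ⟨q, rfl⟩ := σ.surjective p
      exact (key_apply (k ∘ σ) hy q).symm
    · have h' : ¬ ∃ p, (x ∘ σ) p = a := fun ⟨p, hp⟩ => h ⟨σ p, hp⟩
      rw [key, key, dif_neg h, dif_neg h']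

/-- By `key_eq_iff` the entry at (x, y) tests whether x labelled by k and y labelled by l give the
same labelled set, so `dualLE_of_key` applies on the injective tuples, which the falling factorial
counts. -/
lemma dualLE_relabel (l k : κ → Λ) :
    DualLE (relabel (α := α) l k)
      ((Fintype.card α).descFactorial (Fintype.card κ) : ℕ) := by
  classical
  have := dualLE_of_key (Finset.univ.filter fun x : κ → α => Function.Injective x)
    (key k) (key l)
  convert this using 1
  · ext x y
    rw [relabel, Matrix.of_apply, Matrix.of_apply]
    refine if_congr ?_ rfl rfl
    simp only [Finset.mem_filter, Finset.mem_univ, true_and]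
    constructor
    · rintro ⟨hx, h⟩
      have hy : Function.Injective y := by
        obtain ⟨σ, rfl, -⟩ := h
        exact hx.comp σ.injective
      exact ⟨hx, hy, (key_eq_iff l k hx hy).2 h⟩
    · rintro ⟨hx, hy, h⟩
      exact ⟨hx, (key_eq_iff l k hx hy).1 h⟩
  · rw [← Fintype.card_embedding_eq, ← Fintype.card_subtype]
    norm_cast
    exact Fintype.card_congr (Equiv.subtypeInjectiveEquivEmbedding κ α).symm

lemma dualLE_smul_relabel (l k : κ → Λ) (c : ℂ) :
    DualLE ((1 / ((Fintype.card α).descFactorial (Fintype.card κ) : ℂ) * c) •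
      relabel (α := α) l k) ‖c‖ := by
  refine ((dualLE_relabel l k).smul _).mono ?_
  rw [norm_mul, norm_div, norm_one, Complex.norm_natCast, mul_right_comm, one_div]
  -- An inequality rather than an equality: the falling factorial is zero when there are more
  -- registers than elements.
  exact mul_le_of_le_one_left (norm_nonneg _) inv_mul_le_one

lemma norm_twirlVec (φ : Λ → α → ℂ) (l : κ → Λ) (g : α → ℤˣ) (π : Equiv.Perm α) (x : κ → α) :
    ‖twirlVec φ l g π x‖ = ‖prodVec φ l (π.symm ∘ x)‖ := by
  simp [twirlVec, norm_prod, norm_sgn]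

variable {φ : Λ → α → ℂ}

lemma IsOrthoFamily.sum_norm_prodVec (h : IsOrthoFamily φ) (l : κ → Λ) :
    ∑ x, ‖prodVec φ l x‖ ^ 2 = 1 := by
  have e : ∑ x : κ → α, ‖prodVec φ l x‖ ^ 2 = ∏ p, ∑ y, ‖φ (l p) y‖ ^ 2 := by
    rw [Finset.prod_univ_sum, Fintype.piFinset_univ]
    simp [prodVec, norm_prod, Finset.prod_pow]
  simp [e, h.sum_norm_sq]

lemma sum_comp_perm (f : (κ → α) → ℝ) (π : Equiv.Perm α) :
    ∑ x : κ → α, f (π ∘ x) = ∑ x, f x :=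
  Fintype.sum_equiv (Equiv.arrowCongr (Equiv.refl κ) π) _ _ fun _ => rfl

lemma dualLE_twirl (h : IsOrthoFamily φ) (l : κ → Λ) : DualLE (twirl φ l) 1 := by
  refine (DualLE.expect fun g => DualLE.expect fun π => dualLE_vecMulVec_star _).mono ?_
  have : ∀ (g : α → ℤˣ) (π : Equiv.Perm α), ∑ x, ‖twirlVec φ l g π x‖ ^ 2 = 1 := by
    intro g π
    simp_rw [norm_twirlVec]
    rw [sum_comp_perm (fun x => ‖prodVec φ l x‖ ^ 2) π.symm, h.sum_norm_prodVec]
  simp [this]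

/-- An average of unnormalised pure states is bounded by its total mass. The product vector has norm
one and `coef φ l l` is its mass on injective tuples, so the collisions carry the rest. -/
lemma dualLE_collPart (h : IsOrthoFamily φ) (l : κ → Λ) :
    DualLE (collPart φ l) ‖coef φ l l - 1‖ := by
  classical
  refine (DualLE.expect fun g => DualLE.expect fun π => dualLE_vecMulVec_star _).mono ?_
  have h1 : ∀ (g : α → ℤˣ) (π : Equiv.Perm α), ∑ x, ‖collVec φ l g π x‖ ^ 2 =
      ∑ x, if Function.Injective x then 0 else ‖prodVec φ l x‖ ^ 2 := by
    intro g π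
    rw [← sum_comp_perm _ π]
    refine Finset.sum_congr rfl fun x _ => ?_
    have e : π.symm ∘ π ∘ x = x := by funext p; simp
    rw [collVec]
    simp only [π.injective.of_comp_iff]
    split_ifs
    · simp
    · rw [norm_twirlVec, e]
  simp only [h1, Fintype.expect_const]
  have h2 : coef φ l l = ((∑ x : κ ↪ α, ‖prodVec φ l x‖ ^ 2 : ℝ) : ℂ) := by
    rw [coef, injSum]
    push_cast
    refine Finset.sum_congr rfl fun x _ => ?_
    rw [Finset.prod_mul_distrib, ← star_prod, prodVec, Complex.star_def, Complex.mul_conj']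
  have h3 : ∑ x : κ ↪ α, ‖prodVec φ l x‖ ^ 2 =
      ∑ x : κ → α, if Function.Injective x then ‖prodVec φ l x‖ ^ 2 else 0 := by
    rw [← Finset.sum_filter, ← Finset.sum_subtype_eq_sum_filter, Finset.subtype_univ]
    exact (Fintype.sum_equiv (Equiv.subtypeInjectiveEquivEmbedding κ α) _ _ fun x => rfl).symm
  have h4 : (∑ x : κ → α, if Function.Injective x then 0 else ‖prodVec φ l x‖ ^ 2) +
      ∑ x : κ ↪ α, ‖prodVec φ l x‖ ^ 2 = 1 := by
    rw [h3, ← Finset.sum_add_distrib, ← h.sum_norm_prodVec l]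
    refine Finset.sum_congr rfl fun x _ => ?_
    split_ifs <;> simp
  rw [h2, ← Complex.ofReal_one, ← Complex.ofReal_sub, Complex.norm_real, ← h4]
  simp only [sub_add_cancel_right, norm_neg]
  exact le_abs_self _

/-- The uniform state on block-symmetric tuples of distinct elements, with blocks the fibres of
`l`. -/
def blockState (α : Type) [Fintype α] [DecidableEq α] (l : κ → Λ) : Matrix (κ → α) (κ → α) ℂ :=
  (1 / ((Fintype.card α).descFactorial (Fintype.card κ) : ℂ)) • relabel l l

lemma dualLE_blockState (l : κ → Λ) : DualLE (blockState α l) 1 := by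
  simpa [blockState] using dualLE_smul_relabel (α := α) l l 1

lemma dualLE_twirl_sub_two (h : IsOrthoFamily φ) (l : κ → Λ) :
    DualLE (twirl φ l - blockState α l) 2 :=
  ((dualLE_twirl h l).sub (dualLE_blockState l)).mono (by norm_num)

/-- The constant is 5 = 1 + 1 + 3: the collision part, the error of the weight at k = l, and the
terms k ≠ l. If the parenthesised quantity exceeds 1, the trivial bound 2 is already stronger. -/
lemma dualLE_twirl_sub (h : IsOrthoFamily φ) {δ : ℝ} (hδ0 : 0 ≤ δ)
    (hδ : ∀ j y, ‖φ j y‖ ^ 2 ≤ δ) (l : κ → Λ) :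
    DualLE (twirl φ l - blockState α l)
      (5 * ((Fintype.card κ : ℝ) ^ 3 * (Fintype.card Λ : ℝ) ^ 2 * δ)) := by
  set b : ℝ := (Fintype.card κ : ℝ) ^ 3 * (Fintype.card Λ : ℝ) ^ 2 * δ with hb
  rcases lt_or_ge 1 b with hlt | hle
  · exact (dualLE_twirl_sub_two h l).mono (by linarith)
  have hm : (Fintype.card κ : ℝ) ^ 2 * δ ≤ b := by
    rcases isEmpty_or_nonempty κ with hκ | ⟨⟨p0⟩⟩
    · simp [hb]
    · have hm : (1 : ℝ) ≤ Fintype.card κ := by exact_mod_cast Fintype.card_pos_iff.2 ⟨p0⟩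
      have hs : (1 : ℝ) ≤ (Fintype.card Λ : ℝ) ^ 2 :=
        one_le_pow₀ (by exact_mod_cast Fintype.card_pos_iff.2 ⟨l p0⟩)
      rw [hb]
      refine mul_le_mul_of_nonneg_right ?_ hδ0
      calc (Fintype.card κ : ℝ) ^ 2 = (Fintype.card κ : ℝ) ^ 2 * 1 * 1 := by ring
        _ ≤ (Fintype.card κ : ℝ) ^ 2 * Fintype.card κ * (Fintype.card Λ : ℝ) ^ 2 := by gcongr
        _ = _ := by ring
  have hc := norm_coef_self_sub_one_le h hδ0 hδ l
  have e : twirl φ l - blockState α l = collPart φ l +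
      ((1 / ((Fintype.card α).descFactorial (Fintype.card κ) : ℂ) * (coef φ l l - 1)) •
        relabel l l + ∑ k ∈ Finset.univ.erase l,
      (1 / ((Fintype.card α).descFactorial (Fintype.card κ) : ℂ) * coef φ l k) •
        relabel l k) := by
    rw [twirl_eq, blockState, ← Finset.add_sum_erase _ _ (Finset.mem_univ l), mul_sub, sub_smul,
      mul_one]
    abel
  rw [e]
  refine ((dualLE_collPart h l).add ((dualLE_smul_relabel l l _).add
    (DualLE.sum fun k _ => dualLE_smul_relabel l k _))).mono ?_
  linarith [sum_norm_coef_le h hδ0 hδ l hle]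

end decomposition

/-! ### Tail bound for Rademacher sums -/

section tail
variable {α : Type} [Fintype α] [DecidableEq α]

/-- Independence factorises the moment generating function into hyperbolic cosines, and cosh x ≤
exp(x²/2). -/
lemma sum_exp_signs_le (b : α → ℝ) (r : ℝ) :
    ∑ f : α → ℤˣ, Real.exp (r * ∑ y, ((f y : ℤ) : ℝ) * b y) ≤
      Fintype.card (α → ℤˣ) * Real.exp (r ^ 2 * (∑ y, b y ^ 2) / 2) := by
  have e1 : ∀ f : α → ℤˣ, Real.exp (r * ∑ y, ((f y : ℤ) : ℝ) * b y) =
      ∏ y, Real.exp (((f y : ℤ) : ℝ) * (r * b y)) := by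
    intro f
    rw [← Real.exp_sum, Finset.mul_sum]
    congr 1
    exact Finset.sum_congr rfl fun y _ => by ring
  have e2 : ∑ f : α → ℤˣ, ∏ y, Real.exp (((f y : ℤ) : ℝ) * (r * b y)) =
      ∏ y, ∑ e : ℤˣ, Real.exp (((e : ℤ) : ℝ) * (r * b y)) := by
    rw [Finset.prod_univ_sum, Fintype.piFinset_univ]
  have e3 : ∀ x : ℝ, ∑ e : ℤˣ, Real.exp (((e : ℤ) : ℝ) * x) = 2 * Real.cosh x := by
    intro x
    rw [UnitsInt.univ, Finset.sum_pair (by decide), Real.cosh_eq]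
    simp
    ring
  simp_rw [e1]
  rw [e2]
  simp_rw [e3]
  rw [Finset.prod_mul_distrib, Finset.prod_const, Fintype.card_fun, Finset.card_univ]
  have : Fintype.card ℤˣ = 2 := by decide
  rw [this]
  push_cast
  refine mul_le_mul_of_nonneg_left ?_ (by positivity)
  calc ∏ y, Real.cosh (r * b y) ≤ ∏ y, Real.exp ((r * b y) ^ 2 / 2) :=
        Finset.prod_le_prod (fun y _ => (Real.cosh_pos _).le)
          fun y _ => Real.cosh_le_exp_half_sq _
    _ = _ := by
        rw [← Real.exp_sum, Finset.mul_sum, Finset.sum_div]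
        congr 1
        exact Finset.sum_congr rfl fun y _ => by ring

lemma exp_le_exp_add_exp_neg {x c : ℝ} (h : c ^ 2 ≤ x ^ 2) :
    Real.exp c ≤ Real.exp x + Real.exp (-x) := by
  rcases le_abs.1 ((le_abs_self c).trans (sq_le_sq.1 h)) with h | h
  · linarith [Real.exp_le_exp.2 h, Real.exp_pos (-x)]
  · linarith [Real.exp_le_exp.2 h, Real.exp_pos x]

/-- A sub-Gaussian tail bound for complex Rademacher sums. -/
lemma expect_tail_le {a : α → ℂ} {v K : ℝ} (hv : 0 < v) (hK : 0 ≤ K)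
    (ha : ∑ y, ‖a y‖ ^ 2 ≤ v) :
    𝔼 f : α → ℤˣ, (if K * v < ‖∑ y, sgn (f y) * a y‖ ^ 2 then (1 : ℝ) else 0) ≤
      4 * Real.exp (-(K / 4)) := by
  -- The optimal Chernoff parameter: a large norm forces the real or imaginary part to have square
  -- at least Kv/2, so some exponential reaches exp(K/2), while each has mean at most exp(K/4).
  set r : ℝ := √(K / (2 * v)) with hr
  have hr2 : r ^ 2 = K / (2 * v) := Real.sq_sqrt (by positivity)
  set R : (α → ℤˣ) → ℝ := fun f => ∑ y, ((f y : ℤ) : ℝ) * (a y).re with hR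
  set I : (α → ℤˣ) → ℝ := fun f => ∑ y, ((f y : ℤ) : ℝ) * (a y).im with hI
  have hnorm : ∀ f : α → ℤˣ, ‖∑ y, sgn (f y) * a y‖ ^ 2 = R f ^ 2 + I f ^ 2 := by
    intro f
    have h1 : (∑ y, sgn (f y) * a y).re = R f := by
      rw [Complex.re_sum]
      exact Finset.sum_congr rfl fun y _ => by simp [sgn]
    have h2 : (∑ y, sgn (f y) * a y).im = I f := by
      rw [Complex.im_sum]
      exact Finset.sum_congr rfl fun y _ => by simp [sgn]
    rw [Complex.sq_norm, Complex.normSq_apply, h1, h2]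
    ring
  have hpt : ∀ f : α → ℤˣ, (if K * v < ‖∑ y, sgn (f y) * a y‖ ^ 2 then (1 : ℝ) else 0) ≤
      Real.exp (-(K / 2)) * (Real.exp (r * R f) + Real.exp (-r * R f) +
        Real.exp (r * I f) + Real.exp (-r * I f)) := by
    intro f
    split_ifs with h
    · rw [hnorm] at h
      rw [Real.exp_neg, ← div_eq_inv_mul, one_le_div (Real.exp_pos _), neg_mul, neg_mul]
      have key : ∀ z : ℝ, K * v / 2 ≤ z ^ 2 →
          Real.exp (K / 2) ≤ Real.exp (r * z) + Real.exp (-(r * z)) := by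
        intro z hz
        refine exp_le_exp_add_exp_neg ?_
        rw [mul_pow, hr2]
        calc (K / 2) ^ 2 = K / (2 * v) * (K * v / 2) := by field_simp
          _ ≤ K / (2 * v) * z ^ 2 := by gcongr
      have p1 := Real.exp_pos (r * R f)
      have p2 := Real.exp_pos (-(r * R f))
      have p3 := Real.exp_pos (r * I f)
      have p4 := Real.exp_pos (-(r * I f))
      rcases le_total (K * v / 2) (R f ^ 2) with h1 | h1
      · linarith [key _ h1]
      · have h2 : K * v / 2 ≤ I f ^ 2 := by linarith
        linarith [key _ h2]
    · positivity
  have hre : ∑ y, (a y).re ^ 2 ≤ v := by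
    refine (Finset.sum_le_sum fun y _ => ?_).trans ha
    rw [Complex.sq_norm, Complex.normSq_apply]
    nlinarith [sq_nonneg (a y).im]
  have him : ∑ y, (a y).im ^ 2 ≤ v := by
    refine (Finset.sum_le_sum fun y _ => ?_).trans ha
    rw [Complex.sq_norm, Complex.normSq_apply]
    nlinarith [sq_nonneg (a y).re]
  have hmgf : ∀ (b : α → ℝ) (q : ℝ), q ^ 2 = K / (2 * v) → ∑ y, b y ^ 2 ≤ v →
      ∑ f : α → ℤˣ, Real.exp (q * ∑ y, ((f y : ℤ) : ℝ) * b y) ≤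
        Fintype.card (α → ℤˣ) * Real.exp (K / 4) := by
    intro b q hq hb
    refine (sum_exp_signs_le b q).trans
      (mul_le_mul_of_nonneg_left (Real.exp_le_exp.2 ?_) (Nat.cast_nonneg _))
    rw [hq]
    calc K / (2 * v) * (∑ y, b y ^ 2) / 2 ≤ K / (2 * v) * v / 2 := by gcongr
      _ = K / 4 := by field_simp; norm_num
  have hcard : (0 : ℝ) < Fintype.card (α → ℤˣ) := by exact_mod_cast Fintype.card_pos
  rw [Fintype.expect_eq_sum_div_card, div_le_iff₀ hcard]
  refine (Finset.sum_le_sum fun f _ => hpt f).trans ?_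
  rw [← Finset.mul_sum, Finset.sum_add_distrib, Finset.sum_add_distrib, Finset.sum_add_distrib]
  have m1 := hmgf (fun y => (a y).re) r hr2 hre
  have m2 := hmgf (fun y => (a y).re) (-r) (by rw [neg_sq, hr2]) hre
  have m3 := hmgf (fun y => (a y).im) r hr2 him
  have m4 := hmgf (fun y => (a y).im) (-r) (by rw [neg_sq, hr2]) him
  calc _ ≤ Real.exp (-(K / 2)) * (4 * (Fintype.card (α → ℤˣ) * Real.exp (K / 4))) :=
        mul_le_mul_of_nonneg_left (by linarith) (Real.exp_pos _).le
    _ = 4 * (Real.exp (-(K / 2)) * Real.exp (K / 4)) * Fintype.card (α → ℤˣ) := by ring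
    _ = _ := by rw [← Real.exp_add]; congr 3; ring

end tail

/-! ### Algebra of tensor powers -/

section tensor
variable {κ α : Type*} [Fintype κ] [DecidableEq κ] [Fintype α]

lemma tensor_mul (A B : κ → Matrix α α ℂ) :
    tensor A * tensor B = tensor fun p => A p * B p := by
  ext x y
  simp only [tensor, Matrix.mul_apply, Matrix.of_apply]
  rw [Finset.prod_univ_sum, Fintype.piFinset_univ]
  simp [Finset.prod_mul_distrib]

lemma conjTranspose_tensor {κ α : Type*} [Fintype κ] (A : κ → Matrix α α ℂ) :
    (tensor A)ᴴ = tensor fun p => (A p)ᴴ := by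
  ext x y
  simp [tensor, Matrix.conjTranspose_apply]

lemma tensor_one [DecidableEq α] : tensor (fun _ : κ => (1 : Matrix α α ℂ)) = 1 := by
  ext x y
  simp only [tensor, Matrix.of_apply, Matrix.one_apply]
  rw [Finset.prod_ite_zero]
  simp [funext_iff]

end tensor

/-! ### The circuit: flatness of amplitudes and the final estimates -/

section circuit
variable {n s : ℕ}

lemma hadamard_apply (a b : Bool) :
    hadamard a b = (if a && b then -1 else 1) / (Real.sqrt 2 : ℂ) := rfl

lemma norm_hadamard (a b : Bool) : ‖hadamard a b‖ ^ 2 = 1 / 2 := by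
  rw [hadamard_apply, norm_div, Complex.norm_real, div_pow]
  split_ifs <;> simp

lemma hadamard_unitary : hadamardᴴ * hadamard = 1 := by
  have h2 : (Real.sqrt 2 : ℂ) * (Real.sqrt 2 : ℂ) = 2 := by
    rw [← Complex.ofReal_mul, Real.mul_self_sqrt (by norm_num)]; norm_num
  have h0 : (Real.sqrt 2 : ℂ) ≠ 0 := by
    intro h; rw [h] at h2; norm_num at h2
  ext a b
  rw [Matrix.mul_apply]
  cases a <;> cases b <;>
    simp [Matrix.conjTranspose_apply, hadamard_apply, neg_div, h2, ← mul_inv]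
    <;> norm_num

/-- The Hadamard transform on all qubits. -/
def walsh (n : ℕ) : Matrix (Bits n) (Bits n) ℂ := tensor fun _ : Fin n => hadamard

lemma walsh_unitary : (walsh n)ᴴ * walsh n = 1 := by
  rw [walsh, conjTranspose_tensor, tensor_mul]
  simp only [hadamard_unitary]
  exact tensor_one

lemma norm_walsh (x y : Bits n) : ‖walsh n x y‖ ^ 2 = 1 / 2 ^ n := by
  simp [walsh, tensor, norm_prod, ← Finset.prod_pow, norm_hadamard]

/-- The amplitudes of `H^{⊗n} U_f |ψ j⟩`. -/
def spread (ψ : Fin s → EuclideanSpace ℂ (Bits n)) (f : Bits n → ℤˣ) (j : Fin s) : Bits n → ℂ :=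
  walsh n *ᵥ fun y => sgn (f y) * ψ j y

lemma isOrthoFamily_spread {ψ : Fin s → EuclideanSpace ℂ (Bits n)} (hψ : Orthonormal ℂ ψ)
    (f : Bits n → ℤˣ) : IsOrthoFamily (spread ψ f) := by
  intro j k
  have h1 : ∑ y, spread ψ f j y * star (spread ψ f k y) =
      star (spread ψ f k) ⬝ᵥ spread ψ f j := by
    simp [dotProduct, mul_comm]
  rw [h1, spread, spread, Matrix.star_mulVec, ← Matrix.dotProduct_mulVec, Matrix.mulVec_mulVec,
    walsh_unitary, Matrix.one_mulVec]
  have h2 := (orthonormal_iff_ite.1 hψ) k j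
  rw [PiLp.inner_apply] at h2
  rw [show (if j = k then (1 : ℂ) else 0) = if k = j then 1 else 0 by simp only [eq_comm], ← h2,
    dotProduct]
  refine Finset.sum_congr rfl fun y _ => ?_
  simp only [Pi.star_apply, star_mul', star_sgn, RCLike.inner_apply]
  rw [mul_mul_mul_comm, sgn_mul_self, one_mul, mul_comm]
  rfl

lemma permU_mulVec (π : Equiv.Perm (Bits n)) (v : Bits n → ℂ) (x : Bits n) :
    (permU π *ᵥ v) x = v (π.symm x) := by
  rw [permU, Matrix.sum_mulVec, Finset.sum_apply, Finset.sum_eq_single (π.symm x)]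
  · simp [Matrix.single_mulVec, Function.update]
  · intro b _ hb
    have : x ≠ π b := fun h => hb (by simp [h])
    simp [Matrix.single_mulVec, Function.update, this]
  · simp

lemma circuitU_mulVec (f g : Bits n → ℤˣ) (π : Equiv.Perm (Bits n))
    (ψ : Fin s → EuclideanSpace ℂ (Bits n)) (j : Fin s) (x : Bits n) :
    (circuitU f g π *ᵥ ψ j) x = sgn (g (π.symm x)) * spread ψ f j (π.symm x) := by
  rw [circuitU, ← Matrix.mulVec_mulVec, ← Matrix.mulVec_mulVec, ← Matrix.mulVec_mulVec,
    permU_mulVec, phaseU, Matrix.mulVec_diagonal]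
  congr 2
  funext y
  rw [phaseU, Matrix.mulVec_diagonal]
  rfl

lemma ketbra_eq (ψ : EuclideanSpace ℂ (Bits n)) :
    ketbra ψ = Matrix.vecMulVec (ψ : Bits n → ℂ) (star (ψ : Bits n → ℂ)) := rfl

lemma outputState_eq (t : ℕ) (ψ : Fin s → EuclideanSpace ℂ (Bits n)) :
    outputState t ψ = 𝔼 f : Bits n → ℤˣ,
      twirl (spread ψ f) (Prod.fst : Fin s × Fin t → Fin s) := by
  rw [outputState]
  refine Finset.expect_congr rfl fun f _ => ?_
  rw [twirl]
  refine Finset.expect_congr rfl fun g _ => Finset.expect_congr rfl fun π _ => ?_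
  rw [inputState, tensor_mul, tensor_mul]
  ext x y
  simp only [tensor, Matrix.of_apply, Matrix.vecMulVec_apply, Pi.star_apply, twirlVec, prodVec,
    ← Finset.prod_mul_distrib, star_prod]
  refine Finset.prod_congr rfl fun p _ => ?_
  rw [ketbra_eq, Matrix.mul_vecMulVec, Matrix.vecMulVec_mul, ← Matrix.star_mulVec,
    Matrix.vecMulVec_apply, Pi.star_apply, circuitU_mulVec, circuitU_mulVec]
  rfl

lemma exists_prodCongrRight {t : ℕ} {σ : Equiv.Perm (Fin s × Fin t)}
    (h : Prod.fst ∘ σ = Prod.fst) :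
    ∃ τ : Fin s → Equiv.Perm (Fin t), σ = Equiv.prodCongrRight τ := by
  have h1 : ∀ j i, (σ (j, i)).1 = j := fun j i => congrFun h (j, i)
  have hinj : ∀ j, Function.Injective fun i => (σ (j, i)).2 := by
    intro j i i' hi
    have : σ (j, i) = σ (j, i') := Prod.ext ((h1 j i).trans (h1 j i').symm) hi
    exact (Prod.mk.inj (σ.injective this)).2
  refine ⟨fun j => Equiv.ofBijective _ (Finite.injective_iff_bijective.1 (hinj j)), ?_⟩
  ext ⟨j, i⟩
  · simp [h1]
  · simp

/-- The permutations of the registers that preserve the first coordinate are exactly the block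
permutations, and for injective x distinct ones give distinct rearrangements of x. -/
lemma rhoUni_eq (n s t : ℕ) :
    rhoUni n s t = blockState (Bits n) (Prod.fst : Fin s × Fin t → Fin s) := by
  have hc : Fintype.card (Bits n) = 2 ^ n := by simp
  have hk : Fintype.card (Fin s × Fin t) = s * t := by simp
  rw [rhoUni, blockState, hc, hk]
  congr 1
  ext x y
  simp only [Matrix.sum_apply, Matrix.single_apply]
  by_cases hx : Function.Injective x
  · rw [Finset.sum_eq_single ⟨x, hx⟩]
    · by_cases h : ∃ σ : Equiv.Perm (Fin s × Fin t), y = x ∘ σ ∧ Prod.fst ∘ σ = Prod.fst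
      · rw [relabel, Matrix.of_apply, if_pos ⟨hx, h⟩]
        obtain ⟨σ, rfl, h2⟩ := h
        obtain ⟨τ, rfl⟩ := exists_prodCongrRight h2
        rw [Finset.sum_eq_single τ]
        · exact if_pos ⟨rfl, rfl⟩
        · rintro τ' - hne
          refine if_neg fun h : _ ∧ _ => hne ?_
          funext j
          ext i
          have := hx (congrFun h.2 (j, i))
          simp only [Equiv.prodCongrRight_apply, Prod.mk.injEq, true_and] at this
          rw [this]
        · simp
      · rw [relabel, Matrix.of_apply, if_neg fun h' => h h'.2]
        refine Finset.sum_eq_zero fun τ _ => if_neg fun h' : _ ∧ _ => h ?_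
        exact ⟨Equiv.prodCongrRight τ, h'.2.symm, by funext p; rfl⟩
    · intro z _ hz
      exact Finset.sum_eq_zero fun τ _ => if_neg fun h : _ ∧ _ => hz (by ext p; exact congrFun (congrFun h.1 p) _)
    · simp
  · rw [relabel_apply_of_not_injective _ _ hx]
    exact Finset.sum_eq_zero fun z _ => Finset.sum_eq_zero fun τ _ =>
      if_neg fun h : (z : Fin s × Fin t → Bits n) = x ∧ _ = y => hx (h.1 ▸ z.injective)

lemma expect_spread_large_le {ψ : Fin s → EuclideanSpace ℂ (Bits n)} (hψ : Orthonormal ℂ ψ)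
    (j : Fin s) (x : Bits n) :
    𝔼 f : Bits n → ℤˣ, (if 8 * n / 2 ^ n < ‖spread ψ f j x‖ ^ 2 then (1 : ℝ) else 0) ≤
      4 * (1 / 2 ^ n) ^ 2 := by
  have hsum : ∑ y, ‖walsh n x y * ψ j y‖ ^ 2 ≤ (1 / 2 ^ n : ℝ) := by
    simp_rw [norm_mul, mul_pow, norm_walsh]
    rw [← Finset.mul_sum, ← EuclideanSpace.norm_sq_eq, hψ.1 j]
    simp
  -- With K = 8n the tail is 4exp(−2n) ≤ 4/N², small enough to survive the union bound over the N
  -- amplitudes.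
  have := expect_tail_le (K := 8 * n) (by positivity) (by positivity) hsum
  refine le_trans (le_of_eq ?_) (this.trans ?_)
  · refine Finset.expect_congr rfl fun f _ => if_congr ?_ rfl rfl
    rw [mul_one_div]
    have : spread ψ f j x = ∑ y, sgn (f y) * (walsh n x y * ψ j y) :=
      Finset.sum_congr rfl fun y _ => by ring
    rw [this]
  · refine mul_le_mul_of_nonneg_left ?_ (by norm_num)
    have h1 : (2 : ℝ) ≤ Real.exp 1 := by linarith [Real.add_one_le_exp (1 : ℝ)]
    rw [one_div, inv_pow, ← pow_mul, Real.exp_neg]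
    refine inv_anti₀ (by positivity) ?_
    calc (2 : ℝ) ^ (n * 2) ≤ Real.exp 1 ^ (n * 2) := by gcongr
      _ = _ := by rw [← Real.exp_nat_mul]; congr 1; push_cast; ring

lemma dualLE_output_sub {ψ : Fin s → EuclideanSpace ℂ (Bits n)} (t : ℕ) {b : (Bits n → ℤˣ) → ℝ}
    (h : ∀ f, DualLE (twirl (spread ψ f) (Prod.fst : Fin s × Fin t → Fin s) -
      blockState (Bits n) Prod.fst) (b f)) :
    DualLE (outputState t ψ - rhoUni n s t) (𝔼 f, b f) := by
  have : outputState t ψ - rhoUni n s t = 𝔼 f : Bits n → ℤˣ,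
      (twirl (spread ψ f) (Prod.fst : Fin s × Fin t → Fin s) - blockState (Bits n) Prod.fst) := by
    rw [Finset.expect_sub_distrib, Fintype.expect_const, outputState_eq, rhoUni_eq]
  rw [this]
  exact DualLE.expect h

/-- The function `bad` counts the overly large amplitudes. It is at least 1 when flatness fails, so
2 · `bad` dominates the trivial bound there, and its mean is at most sN · 4/N² = 4s/N. -/
lemma dualLE_output_sub_of_pos {ψ : Fin s → EuclideanSpace ℂ (Bits n)} (hψ : Orthonormal ℂ ψ)
    (t : ℕ) : DualLE (outputState t ψ - rhoUni n s t)
      (8 * s / 2 ^ n + 5 * (((s * t : ℕ) : ℝ) ^ 3 * (s : ℝ) ^ 2 * (8 * n / 2 ^ n))) := by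
  set B : ℝ := 5 * (((s * t : ℕ) : ℝ) ^ 3 * (s : ℝ) ^ 2 * (8 * n / 2 ^ n)) with hB
  set δ : ℝ := 8 * n / 2 ^ n with hδ
  have hδ0 : 0 ≤ δ := by positivity
  have hB0 : 0 ≤ B := by positivity
  set bad : (Bits n → ℤˣ) → ℝ := fun f =>
    ∑ j : Fin s, ∑ x : Bits n, if δ < ‖spread ψ f j x‖ ^ 2 then (1 : ℝ) else 0 with hbad
  have hbad0 : ∀ f, 0 ≤ bad f := fun f =>
    Finset.sum_nonneg fun j _ => Finset.sum_nonneg fun x _ => by split_ifs <;> norm_num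
  have h := dualLE_output_sub (ψ := ψ) t (b := fun f => 2 * bad f + B) (fun f => by
    by_cases hf : ∀ j x, ‖spread ψ f j x‖ ^ 2 ≤ δ
    · refine (dualLE_twirl_sub (isOrthoFamily_spread hψ f) hδ0 hf _).mono ?_
      have := hbad0 f
      simp only [Fintype.card_prod, Fintype.card_fin]
      linarith
    · push Not at hf
      obtain ⟨j, x, hjx⟩ := hf
      refine (dualLE_twirl_sub_two (isOrthoFamily_spread hψ f) _).mono ?_
      have : 1 ≤ bad f := by
        calc (1 : ℝ) = if δ < ‖spread ψ f j x‖ ^ 2 then (1 : ℝ) else 0 := (if_pos hjx).symm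
          _ ≤ ∑ x : Bits n, if δ < ‖spread ψ f j x‖ ^ 2 then (1 : ℝ) else 0 :=
            Finset.single_le_sum (f := fun x => if δ < ‖spread ψ f j x‖ ^ 2 then (1 : ℝ) else 0)
              (fun x _ => by split_ifs <;> norm_num) (Finset.mem_univ x)
          _ ≤ bad f :=
            Finset.single_le_sum
              (f := fun j => ∑ x : Bits n, if δ < ‖spread ψ f j x‖ ^ 2 then (1 : ℝ) else 0)
              (fun j _ => Finset.sum_nonneg fun x _ => by split_ifs <;> norm_num)
              (Finset.mem_univ j)
      linarith)
  refine h.mono ?_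
  rw [Finset.expect_add_distrib, Fintype.expect_const, ← Finset.mul_expect]
  have hE : 𝔼 f, bad f ≤ ∑ j : Fin s, ∑ x : Bits n, (4 * (1 / 2 ^ n) ^ 2 : ℝ) := by
    rw [hbad, Finset.expect_sum_comm]
    refine Finset.sum_le_sum fun j _ => ?_
    rw [Finset.expect_sum_comm]
    exact Finset.sum_le_sum fun x _ => expect_spread_large_le hψ j x
  have e : ∑ j : Fin s, ∑ x : Bits n, (4 * (1 / 2 ^ n) ^ 2 : ℝ) = 4 * s / 2 ^ n := by
    simp
    field_simp
  rw [e] at hE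
  have : 2 * (4 * (s : ℝ) / 2 ^ n) = 8 * s / 2 ^ n := by ring
  linarith

lemma dualLE_output_sub_of_eq_zero {ψ : Fin s → EuclideanSpace ℂ (Bits n)}
    (hψ : Orthonormal ℂ ψ) (t : ℕ) (h0 : s * t = 0) :
    DualLE (outputState t ψ - rhoUni n s t) 0 := by
  have h := dualLE_output_sub (ψ := ψ) t (b := fun _ => 0) (fun f => by
    have ho := isOrthoFamily_spread hψ f
    refine (dualLE_twirl_sub ho zero_le_one (fun j x => ?_) _).mono ?_
    · rw [← ho.sum_norm_sq j]
      exact Finset.single_le_sum (f := fun x => ‖spread ψ f j x‖ ^ 2)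
        (fun x _ => by positivity) (Finset.mem_univ x)
    · rw [Fintype.card_prod, Fintype.card_fin, Fintype.card_fin, h0]
      simp)
  simpa using h

end circuit

end OrthPRU

end

theorem lemma4p1 :
    ∃ C : ℝ, ∀ (n s t : ℕ), 1 ≤ n →
      ∀ ψ : Fin s → EuclideanSpace ℂ (OrthPRU.Bits n), Orthonormal ℂ ψ →
        OrthPRU.traceNorm (OrthPRU.outputState t ψ - OrthPRU.rhoUni n s t) ≤
          C * ((s : ℝ) ^ 6 * (t : ℝ) ^ 4 * (n : ℝ) ^ 2 / 2 ^ n) := by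
  -- 48 = 8 + 40: the non-flat f contribute 8s/N and the flat ones 5 · 8 · s⁵t³n/N.
  refine ⟨48, fun n s t hn ψ hψ => OrthPRU.traceNorm_le_of_dualLE ?_⟩
  rcases Nat.eq_zero_or_pos (s * t) with h0 | h0
  -- Without registers the right-hand side is zero, even if s > 0, so the error 8s/N is not
  -- affordable and the sharper bound is needed.
  · exact (OrthPRU.dualLE_output_sub_of_eq_zero hψ t h0).mono (by positivity)
  refine (OrthPRU.dualLE_output_sub_of_pos hψ t).mono ?_
  have hs : (1 : ℝ) ≤ s := by exact_mod_cast Nat.pos_of_mul_pos_right h0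
  have ht : (1 : ℝ) ≤ t := by exact_mod_cast Nat.pos_of_mul_pos_left h0
  have hn' : (1 : ℝ) ≤ n := by exact_mod_cast hn
  have h1 : (s : ℝ) ≤ (s : ℝ) ^ 6 * (t : ℝ) ^ 4 * (n : ℝ) ^ 2 := by
    calc (s : ℝ) = (s : ℝ) ^ 1 * 1 * 1 := by ring
      _ ≤ (s : ℝ) ^ 6 * (t : ℝ) ^ 4 * (n : ℝ) ^ 2 := by
        gcongr
        · norm_num
        · exact one_le_pow₀ ht
        · exact one_le_pow₀ hn'
  have h2 : (s : ℝ) ^ 5 * (t : ℝ) ^ 3 * (n : ℝ) ^ 1 ≤ (s : ℝ) ^ 6 * (t : ℝ) ^ 4 * (n : ℝ) ^ 2 := by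
    gcongr <;> norm_num
  calc 8 * (s : ℝ) / 2 ^ n + 5 * (((s * t : ℕ) : ℝ) ^ 3 * (s : ℝ) ^ 2 * (8 * n / 2 ^ n))
      = (8 * s + 40 * ((s : ℝ) ^ 5 * (t : ℝ) ^ 3 * (n : ℝ) ^ 1)) / 2 ^ n := by
        push_cast; ring
    _ ≤ (48 * ((s : ℝ) ^ 6 * (t : ℝ) ^ 4 * (n : ℝ) ^ 2)) / 2 ^ n := by
        gcongr
        linarith
    _ = _ := by ring
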